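/- Proposition. For every $\alpha\in(0,1)$ there is a constant $c(\alpha)>0$, depending only on $\alpha$, such that for every irreducible continuous-time Markov chain $(X_t)_{t\ge 0}$ (with right-continuous trajectories) on a finite state space $E$, with generator $Q$, transition probabilities $p_t(x,y)=\mathbb{P}_x(X_t=y)=(e^{tQ})(x,y)$ and stationary distribution $\pi$, $$T_{\mathrm{hit}}(\alpha)\;\le\; c(\alpha)\,T_{\mathrm{rmix}}(1/4).$$ Here $$T_{\mathrm{hit}}(\alpha)=\sup\{\mathbb{E}_x[H_A] : x\in E,\ \emptyset\ne A\subseteq E,\ \pi(A)\ge\alpha\},\qquad H_A=\inf\{t\ge 0 : X_t\in A\},$$ and $T_{\mathrm{rmix}}(\delta)$ is the infimum of all $t\ge 0$ for which there exists a probability measure $\mu$ on $[0,t]$ such that $$d_{\mathrm{TV}}\Big(\int_{[0,t]}p_s(x,\cdot)\,\mu(ds),\,\pi\Big)\le\delta\quad\text{for all }x\in E,$$ where $d_{\mathrm{TV}}(\mu,\nu)=\tfrac12\sum_{a\in E}|\mu(a)-\nu(a)|$ is the total variation distance. -/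

import Mathlib

open scoped NNReal ENNReal Topology
open MeasureTheory

noncomputable section

namespace FiniteChain

variable {E : Type*} [Fintype E] [DecidableEq E] {Ω : Type*}

/-- `Q` is the generator matrix of a continuous-time Markov chain on the finite set `E`: for
`x ≠ y` the entry `Q x y` is the transition rate `q(x,y) ≥ 0`, and each row sums to `0`. -/
structure IsGenerator (Q : Matrix E E ℝ) : Prop where
  rate_nonneg : ∀ x y, x ≠ y → 0 ≤ Q x y
  row_sum : ∀ x, ∑ y, Q x y = 0

/-- Irreducibility: any state is reached from any other one through jumps of positive rate. -/
def IsIrreducible (Q : Matrix E E ℝ) : Prop :=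
  ∀ x y, Relation.ReflTransGen (fun a b => a ≠ b ∧ 0 < Q a b) x y

/-- `π` is a stationary probability distribution of the chain with generator `Q`. -/
structure IsStationary (Q : Matrix E E ℝ) (π : E → ℝ) : Prop where
  nonneg : ∀ x, 0 ≤ π x
  sum_eq_one : ∑ x, π x = 1
  stationary : ∀ y, ∑ x, π x * Q x y = 0

/-- The transition probabilities `p_t(x,y)`, as a matrix: `p_t = exp (t Q)`. -/
def transProb (Q : Matrix E E ℝ) (t : ℝ) : Matrix E E ℝ :=
  NormedSpace.exp (t • Q)

/-- `X` is a right-continuous `E`-valued process (`E` being discrete) which, under each `P x`, is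
the continuous-time Markov chain with generator `Q` started from `x`: its finite-dimensional
distributions are
`P x (X_{t₀} = y₀, …, X_{tₙ} = yₙ) = p_{t₀}(x,y₀) p_{t₁-t₀}(y₀,y₁) ⋯ p_{tₙ-tₙ₋₁}(yₙ₋₁,yₙ)`
for `0 ≤ t₀ ≤ t₁ ≤ … ≤ tₙ`. -/
structure IsMarkovChain [MeasurableSpace Ω] (Q : Matrix E E ℝ)
    (X : ℝ≥0 → Ω → E) (P : E → Measure Ω) : Prop where
  isProbability : ∀ x, IsProbabilityMeasure (P x)
  measurable : ∀ t y, MeasurableSet {ω | X t ω = y}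
  right_continuous : ∀ ω t, ∀ᶠ s in 𝓝[≥] t, X s ω = X t ω
  finite_dim : ∀ (x : E) (n : ℕ) (t : ℕ → ℝ≥0) (y : ℕ → E), Monotone t →
    P x {ω | ∀ i ≤ n, X (t i) ω = y i} =
      ENNReal.ofReal (transProb Q (t 0) x (y 0) *
        ∏ i ∈ Finset.range n, transProb Q ((t (i + 1) : ℝ) - (t i : ℝ)) (y i) (y (i + 1)))

/-- The hitting time `H_A = inf {t ≥ 0 : X_t ∈ A}`, which is `∞` if `A` is never visited. -/
def hittingTime (X : ℝ≥0 → Ω → E) (A : Finset E) (ω : Ω) : ℝ≥0∞ :=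
  ⨅ (t : ℝ≥0) (_ : X t ω ∈ A), (t : ℝ≥0∞)

/-- `T_hit(α)`, the supremum of `E_x[H_A]` over `x ∈ E` and nonempty `A ⊆ E` with `π(A) ≥ α`. -/
def Thit [MeasurableSpace Ω] (X : ℝ≥0 → Ω → E) (P : E → Measure Ω) (π : E → ℝ) (α : ℝ) :
    ℝ≥0∞ :=
  ⨆ (x : E) (A : Finset E) (_ : A.Nonempty) (_ : α ≤ ∑ a ∈ A, π a),
    ∫⁻ ω, hittingTime X A ω ∂(P x)

/-- Total variation distance between probability distributions on `E`. -/
def dTV (μ ν : E → ℝ) : ℝ :=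
  (1 / 2) * ∑ a, |μ a - ν a|

/-- `T_rmix(δ)`, the infimum of the `t ≥ 0` for which there is a probability measure `μ` on `[0,t]`
with `d_TV(∫_{[0,t]} p_s(x,·) μ(ds), π) ≤ δ` for all `x ∈ E`. -/
def Trmix (Q : Matrix E E ℝ) (π : E → ℝ) (δ : ℝ) : ℝ≥0∞ :=
  ⨅ (t : ℝ≥0) (_ : ∃ μ : Measure ℝ, IsProbabilityMeasure μ ∧ μ (Set.Icc 0 (t : ℝ))ᶜ = 0 ∧
      ∀ x, dTV (fun y => ∫ s in Set.Icc 0 (t : ℝ), transProb Q s x y ∂μ) π ≤ δ),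
    (t : ℝ≥0∞)

end FiniteChain

end

noncomputable section

namespace FiniteChain

variable {E : Type*} [Fintype E] [DecidableEq E] {Ω : Type*}

/-! ### The transition semigroup -/

/-! Let `μ` be a law on `[0,t]` admissible in `Trmix`. The averaged matrix `K = ∫ p_s dμ` is
stochastic, preserves `π` and halves centred functions in sup norm, so `K^k 1_A ≥ π(A) - 2^{-k} ≥
α/2` once `2^{-k} ≤ α/2`. As `K^k` averages `p_s` over a sum of `k` independent times, some fixed `s
≤ k t` has `P_x(X_s ∈ A) ≥ α/2` (`exists_transProb_ge`). By the Markov property, avoiding `A` up to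
time `n k t` has probability at most `(1 - α/2)^n` (`measure_avoid_le`). Summing this tail gives
`E_x[H_A] ≤ k t · 2/α`, so `c = 2k/α` works. -/

lemma transProb_zero (Q : Matrix E E ℝ) : transProb Q 0 = 1 := by
  simp [transProb]

lemma transProb_add (Q : Matrix E E ℝ) (s t : ℝ) :
    transProb Q (s + t) = transProb Q s * transProb Q t := by
  unfold transProb
  rw [add_smul]
  exact Matrix.exp_add_of_commute _ _ (((Commute.refl Q).smul_left s).smul_right t)

section MatrixNorm

attribute [local instance] Matrix.linftyOpNormedRing Matrix.linftyOpNormedAlgebra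

lemma continuous_transProb (Q : Matrix E E ℝ) : Continuous (transProb Q) := by
  let _ : NormedAlgebra ℚ (Matrix E E ℝ) := .restrictScalars ℚ ℝ _
  exact NormedSpace.exp_continuous.comp (continuous_id.smul continuous_const)

/-- With `A` a matrix of constant rows or columns and `B` or `C` zero, this yields row sums and
stationarity of `p_t` without differentiating in `t`. -/
lemma semiconjBy_exp {A B C : Matrix E E ℝ} (h : A * B = C * A) :
    A * NormedSpace.exp B = NormedSpace.exp C * A := by
  let _ : NormedAlgebra ℚ (Matrix E E ℝ) := .restrictScalars ℚ ℝ _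
  exact SemiconjBy.exp_right (x := A) (a := B) (b := C) h

end MatrixNorm

lemma continuous_transProb_apply (Q : Matrix E E ℝ) (x y : E) :
    Continuous fun t => transProb Q t x y :=
  (continuous_transProb Q).matrix_elem x y

lemma sum_transProb {Q : Matrix E E ℝ} (hQ : IsGenerator Q) (t : ℝ) (x : E) :
    ∑ y, transProb Q t x y = 1 := by
  have h : (Matrix.of fun _ _ : E => (1 : ℝ)) * (0 : Matrix E E ℝ) =
      (t • Q) * Matrix.of fun _ _ : E => (1 : ℝ) := by
    ext a b
    simp [Matrix.mul_apply, ← Finset.mul_sum, hQ.row_sum]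
  have h2 := congrFun (congrFun (semiconjBy_exp h) x) x
  simpa [Matrix.mul_apply, transProb, Matrix.one_apply] using h2.symm

lemma sum_mul_transProb {Q : Matrix E E ℝ} {π : E → ℝ} (hπ : IsStationary Q π) (t : ℝ) (y : E) :
    ∑ x, π x * transProb Q t x y = π y := by
  have h : (Matrix.of fun _ x : E => π x) * (t • Q) =
      (0 : Matrix E E ℝ) * Matrix.of fun _ x : E => π x := by
    ext a b
    simp [Matrix.mul_apply, mul_left_comm _ t, ← Finset.mul_sum, hπ.stationary]
  have h2 := congrFun (congrFun (semiconjBy_exp h) y) y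
  simpa [Matrix.mul_apply, transProb, Matrix.one_apply] using h2

/-! ### Randomized transition matrices -/

/-- The transition matrix `∫ p_s ν(ds)` of the chain observed at an independent random time with
distribution `ν`. -/
def mixedTransProb (Q : Matrix E E ℝ) (ν : Measure ℝ) : Matrix E E ℝ :=
  Matrix.of fun x y => ∫ s, transProb Q s x y ∂ν

section Mixed

variable {Q : Matrix E E ℝ} {π : E → ℝ} {ν : Measure ℝ} {t : ℝ}

lemma integrable_of_continuous [IsFiniteMeasure ν] (hν : ν (Set.Icc 0 t)ᶜ = 0) {f : ℝ → ℝ}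
    (hf : Continuous f) : Integrable f ν := by
  have h : ν.restrict (Set.Icc 0 t) = ν :=
    Measure.restrict_eq_self_of_ae_mem (by rwa [ae_iff])
  rw [← h]
  exact hf.continuousOn.integrableOn_compact isCompact_Icc

lemma sum_mixedTransProb [IsProbabilityMeasure ν] (hν : ν (Set.Icc 0 t)ᶜ = 0)
    (hQ : IsGenerator Q) (x : E) : ∑ y, mixedTransProb Q ν x y = 1 := by
  simp only [mixedTransProb, Matrix.of_apply]
  rw [← integral_finsetSum _ fun y _ =>
    integrable_of_continuous hν (continuous_transProb_apply Q x y)]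
  simp [sum_transProb hQ]

lemma sum_mul_mixedTransProb [IsProbabilityMeasure ν] (hν : ν (Set.Icc 0 t)ᶜ = 0)
    (hπ : IsStationary Q π) (y : E) : ∑ x, π x * mixedTransProb Q ν x y = π y := by
  simp only [mixedTransProb, Matrix.of_apply, ← integral_const_mul]
  rw [← integral_finsetSum _ fun x _ =>
    (integrable_of_continuous hν (continuous_transProb_apply Q x y)).const_mul _]
  simp [sum_mul_transProb hπ]

omit [DecidableEq E] in
/-- A stochastic matrix with rows within total variation distance `1/4` of its stationary
distribution contracts centred functions by a factor `1/2`. -/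
lemma abs_mulVec_iterate_sub_le {K : Matrix E E ℝ} (hK : ∀ x, ∑ y, K x y = 1)
    (hπK : ∀ y, ∑ x, π x * K x y = π y) (hπ : ∑ x, π x = 1) (hd : ∀ x, dTV (K x) π ≤ 1 / 4)
    {f : E → ℝ} (hf : ∀ x, |f x - ∑ a, π a * f a| ≤ 1) (k : ℕ) (x : E) :
    |(K.mulVec^[k] f) x - ∑ a, π a * f a| ≤ (1 / 2) ^ k := by
  have hmean : ∀ j, ∑ a, π a * (K.mulVec^[j] f) a = ∑ a, π a * f a := by
    intro j
    induction j with
    | zero => rfl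
    | succ j ih =>
      rw [← ih, Function.iterate_succ_apply']
      simp only [Matrix.mulVec, dotProduct, Finset.mul_sum]
      rw [Finset.sum_comm]
      refine Finset.sum_congr rfl fun y _ => ?_
      simp only [← mul_assoc]
      rw [← Finset.sum_mul, hπK]
  induction k generalizing x with
  | zero => simpa using hf x
  | succ j ih =>
    set g := K.mulVec^[j] f with hg
    set m := ∑ a, π a * f a with hm
    have h1 : (K.mulVec^[j + 1] f) x - m = ∑ y, (K x y - π y) * (g y - m) := by
      -- `K x` and `π` have equal mass, so `m` can be subtracted freely; and `π g = m`.
      rw [Function.iterate_succ_apply', ← hg]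
      simp only [sub_mul, mul_sub, Finset.sum_sub_distrib, ← Finset.sum_mul, hK, hπ, hmean j,
        Matrix.mulVec, dotProduct, hg]
      ring
    rw [h1]
    have h2 := hd x
    unfold dTV at h2
    calc |∑ y, (K x y - π y) * (g y - m)| ≤ ∑ y, |(K x y - π y) * (g y - m)| :=
          Finset.abs_sum_le_sum_abs _ _
      _ ≤ ∑ y, |K x y - π y| * (1 / 2) ^ j := by
          refine Finset.sum_le_sum fun y _ => ?_
          rw [abs_mul]
          exact mul_le_mul_of_nonneg_left (ih y) (abs_nonneg _)
      _ = (∑ y, |K x y - π y|) * (1 / 2) ^ j := by rw [Finset.sum_mul]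
      _ ≤ (1 / 2) * (1 / 2) ^ j := by
          gcongr
          linarith
      _ = (1 / 2) ^ (j + 1) := by ring

lemma transProb_mulVec_mixed [IsProbabilityMeasure ν] (hν : ν (Set.Icc 0 t)ᶜ = 0)
    (r : ℝ) (g : E → ℝ) (x : E) :
    (transProb Q r).mulVec ((mixedTransProb Q ν).mulVec g) x =
      ∫ s, (transProb Q (r + s)).mulVec g x ∂ν := by
  have hint : ∀ y z, Integrable (fun s => transProb Q s y z) ν := fun y z =>
    integrable_of_continuous hν (continuous_transProb_apply Q y z)
  simp only [transProb_add, ← Matrix.mulVec_mulVec]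
  simp only [Matrix.mulVec, dotProduct, mixedTransProb, Matrix.of_apply]
  rw [integral_finsetSum _ fun y _ => (integrable_finsetSum _ fun z _ =>
    (hint y z).mul_const _).const_mul _]
  refine Finset.sum_congr rfl fun y _ => ?_
  rw [integral_const_mul, integral_finsetSum _ fun z _ => (hint y z).mul_const _]
  simp only [integral_mul_const]

/-- Some deterministic time does at least as well as a sum of `j` independent random times. -/
lemma exists_mixed_iterate_le [IsProbabilityMeasure ν] (hν : ν (Set.Icc 0 t)ᶜ = 0)
    (f : E → ℝ) (x : E) (j : ℕ) (r : ℝ) :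
    ∃ s ∈ Set.Icc 0 (j * t), (transProb Q r).mulVec ((mixedTransProb Q ν).mulVec^[j] f) x ≤
      (transProb Q (r + s)).mulVec f x := by
  induction j generalizing r with
  | zero => exact ⟨0, by simp, by simp⟩
  | succ j ih =>
    rw [Function.iterate_succ_apply', transProb_mulVec_mixed hν]
    have hc : Continuous fun s =>
        (transProb Q (r + s)).mulVec ((mixedTransProb Q ν).mulVec^[j] f) x := by
      simp only [Matrix.mulVec, dotProduct]
      exact continuous_finsetSum _ fun y _ =>
        ((continuous_transProb_apply Q x y).comp (continuous_const.add continuous_id)).mul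
          continuous_const
    -- A function is at least its mean somewhere off any null set, here off the complement of
    -- `[0,t]`. The chosen `s` is then absorbed into `r`.
    obtain ⟨s, hs, hle⟩ := exists_notMem_null_integral_le (integrable_of_continuous hν hc) hν
    rw [Set.notMem_compl_iff] at hs
    obtain ⟨s', hs', hle'⟩ := ih (r + s)
    refine ⟨s + s', ⟨add_nonneg hs.1 hs'.1, ?_⟩, ?_⟩
    · have := hs.2
      have := hs'.2
      push_cast
      linarith
    · rw [← add_assoc]
      exact hle.trans hle'

end Mixed

/-- The time `s` may depend on `x`; only its bound `k * t` is uniform. -/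
lemma exists_transProb_ge {Q : Matrix E E ℝ} {π : E → ℝ} {μ : Measure ℝ} {t : ℝ≥0}
    (hQ : IsGenerator Q) (hπ : IsStationary Q π) [IsProbabilityMeasure μ]
    (hμ : μ (Set.Icc 0 (t : ℝ))ᶜ = 0)
    (hd : ∀ x, dTV (fun y => ∫ s in Set.Icc 0 (t : ℝ), transProb Q s x y ∂μ) π ≤ 1 / 4)
    {α : ℝ} {k : ℕ} (hk : (1 / 2) ^ k ≤ α / 2) {A : Finset E} (hA : α ≤ ∑ a ∈ A, π a) (x : E) :
    ∃ s : ℝ≥0, s ≤ k * t ∧ α / 2 ≤ ∑ y ∈ A, transProb Q s x y := by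
  have hres : μ.restrict (Set.Icc 0 (t : ℝ)) = μ :=
    Measure.restrict_eq_self_of_ae_mem (by rwa [ae_iff])
  rw [hres] at hd
  set f : E → ℝ := fun y => if y ∈ A then 1 else 0 with hf
  have hmean : ∑ a, π a * f a = ∑ a ∈ A, π a := by simp [hf, Finset.sum_ite_mem]
  have hle1 : ∑ a ∈ A, π a ≤ 1 := hπ.sum_eq_one ▸
    Finset.sum_le_sum_of_subset_of_nonneg (Finset.subset_univ A) fun a _ _ => hπ.nonneg a
  have hnn : 0 ≤ ∑ a ∈ A, π a := Finset.sum_nonneg fun a _ => hπ.nonneg a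
  have hosc : ∀ y, |f y - ∑ a, π a * f a| ≤ 1 := by
    intro y
    rw [hmean, abs_le]
    by_cases hy : y ∈ A
    · simp only [hf, hy, if_true]
      constructor <;> linarith
    · simp only [hf, hy, if_false]
      constructor <;> linarith
  have h1 := abs_mulVec_iterate_sub_le (sum_mixedTransProb hμ hQ) (sum_mul_mixedTransProb hμ hπ)
    hπ.sum_eq_one hd hosc k x
  obtain ⟨s, hs, hle⟩ := exists_mixed_iterate_le (Q := Q) hμ f x k 0
  refine ⟨⟨s, hs.1⟩, by exact_mod_cast hs.2, ?_⟩
  rw [transProb_zero, Matrix.one_mulVec, zero_add] at hle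
  have h2 : (transProb Q s).mulVec f x = ∑ y ∈ A, transProb Q s x y := by
    simp [hf, Matrix.mulVec, dotProduct, Finset.sum_ite_mem]
  rw [hmean] at h1
  rw [h2] at hle
  have h3 := (abs_le.1 h1).1
  change α / 2 ≤ ∑ y ∈ A, transProb Q s x y
  linarith

/-! ### The Markov property on cylinder events -/

/-- `C` is a cylinder event of the process `X` whose last constraint is `X τ = y`. -/
def IsCylinder (X : ℝ≥0 → Ω → E) (τ : ℝ≥0) (y : E) (C : Set Ω) : Prop :=
  ∃ (n : ℕ) (t : ℕ → ℝ≥0) (z : ℕ → E), Monotone t ∧ t n = τ ∧ z n = y ∧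
    C = {ω | ∀ i ≤ n, X (t i) ω = z i}

omit [Fintype E] [DecidableEq E] in
lemma isCylinder_single (X : ℝ≥0 → Ω → E) (τ : ℝ≥0) (y : E) :
    IsCylinder X τ y {ω | X τ ω = y} :=
  ⟨0, fun _ => τ, fun _ => y, monotone_const, rfl, rfl, by simp⟩

omit [Fintype E] [DecidableEq E] in
lemma exists_extension {X : ℝ≥0 → Ω → E} {n : ℕ} {t : ℕ → ℝ≥0} {z : ℕ → E} (ht : Monotone t)
    (s : ℝ≥0) (w : E) :
    ∃ (t' : ℕ → ℝ≥0) (z' : ℕ → E), Monotone t' ∧ (∀ i ≤ n, t' i = t i) ∧ (∀ i ≤ n, z' i = z i) ∧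
      t' (n + 1) = t n + s ∧ z' (n + 1) = w ∧
      {ω | ∀ i ≤ n, X (t i) ω = z i} ∩ {ω | X (t n + s) ω = w} =
        {ω | ∀ i ≤ n + 1, X (t' i) ω = z' i} := by
  -- The time sequence is frozen after index `n + 1` to stay monotone on all of `ℕ`.
  refine ⟨fun i => if i ≤ n then t i else t n + s, fun i => if i ≤ n then z i else w, ?_,
    fun i hi => by simp [hi], fun i hi => by simp [hi], by simp, by simp, ?_⟩
  · intro i j hij
    dsimp only
    split_ifs with h1 h2 h2
    · exact ht hij
    · exact (ht h1).trans le_self_add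
    · omega
    · exact le_rfl
  · ext ω
    simp only [Set.mem_inter_iff, Set.mem_ofPred_eq]
    constructor
    · rintro ⟨h1, h2⟩ i hi
      split_ifs with h
      · exact h1 i h
      · exact h2
    · intro h
      exact ⟨fun i hi => by simpa [hi] using h i (by omega), by simpa using h (n + 1) le_rfl⟩

omit [Fintype E] [DecidableEq E] in
lemma IsCylinder.inter {X : ℝ≥0 → Ω → E} {τ : ℝ≥0} {y : E} {C : Set Ω} (hC : IsCylinder X τ y C)
    (s : ℝ≥0) (w : E) : IsCylinder X (τ + s) w (C ∩ {ω | X (τ + s) ω = w}) := by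
  obtain ⟨n, t, z, ht, rfl, rfl, rfl⟩ := hC
  obtain ⟨t', z', ht', -, -, h1, h2, h⟩ := exists_extension (X := X) (n := n) (z := z) ht s w
  exact ⟨n + 1, t', z', ht', h1, h2, h⟩

section Chain

variable [MeasurableSpace Ω] {Q : Matrix E E ℝ} {X : ℝ≥0 → Ω → E} {P : E → Measure Ω}

/-- The law of `X s` only gives `max (p_s) 0`, since `ENNReal.ofReal` truncates. Both `p_s(x,·)` and
its positive part sum to `1`, so nothing was truncated. -/
lemma transProb_nonneg (hQ : IsGenerator Q) (hX : IsMarkovChain Q X P) (s : ℝ≥0) (x y : E) :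
    0 ≤ transProb Q s x y := by
  have hp : ∀ y, P x {ω | X s ω = y} = ENNReal.ofReal (transProb Q s x y) := fun y => by
    simpa using hX.finite_dim x 0 (fun _ => s) (fun _ => y) monotone_const
  have htot : ∑ y, P x {ω | X s ω = y} = 1 := by
    have := hX.isProbability x
    rw [← measure_biUnion_finset (fun a _ b _ hab => Set.disjoint_left.2 fun ω h1 h2 =>
      hab (h1.symm.trans h2)) fun y _ => hX.measurable s y]
    rw [← measure_univ (μ := P x)]
    congr 1
    ext ω
    simp
  have hsum : ∑ y, max (transProb Q s x y) 0 = ∑ y, transProb Q s x y := by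
    have h := congrArg ENNReal.toReal htot
    rw [ENNReal.toReal_sum fun y _ => by simp [hp]] at h
    simpa [hp, ENNReal.toReal_ofReal', sum_transProb hQ] using h
  have h := (Finset.sum_eq_sum_iff_of_le fun y _ => le_max_left (transProb Q s x y) 0).1 hsum.symm
    y (Finset.mem_univ y)
  rw [h]
  exact le_max_right _ _

lemma IsCylinder.measure_inter (hQ : IsGenerator Q) (hX : IsMarkovChain Q X P) {τ : ℝ≥0} {y : E}
    {C : Set Ω} (hC : IsCylinder X τ y C) (x : E) (s : ℝ≥0) (w : E) :
    P x (C ∩ {ω | X (τ + s) ω = w}) = P x C * ENNReal.ofReal (transProb Q s y w) := by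
  obtain ⟨n, t, z, ht, rfl, rfl, rfl⟩ := hC
  obtain ⟨t', z', ht', het, hez, h1, h2, h⟩ :=
    exists_extension (X := X) (n := n) (z := z) ht s w
  rw [h, hX.finite_dim x (n + 1) t' z' ht', hX.finite_dim x n t z ht, Finset.prod_range_succ,
    ← mul_assoc, ← ENNReal.ofReal_mul' (transProb_nonneg hQ hX s _ _), h1, h2, het n le_rfl,
    hez n le_rfl, het 0 n.zero_le, hez 0 n.zero_le]
  congr 3
  · refine Finset.prod_congr rfl fun i hi => ?_
    have hi' := Finset.mem_range.1 hi
    rw [het i hi'.le, het (i + 1) hi', hez i hi'.le, hez (i + 1) hi']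
  · push_cast
    simp

lemma sum_ofReal_transProb (hQ : IsGenerator Q) (hX : IsMarkovChain Q X P) (s : ℝ≥0) (x : E) :
    ∑ y, ENNReal.ofReal (transProb Q s x y) = 1 := by
  rw [← ENNReal.ofReal_sum_of_nonneg fun y _ => transProb_nonneg hQ hX s x y,
    sum_transProb hQ, ENNReal.ofReal_one]

/-- If from every state the set `A` is occupied with probability at least `β` at some time before
`T`, then avoiding `A` during `n` further periods of length `T` has probability at most
`(1 - β) ^ n`, given a cylinder event of the past. -/
lemma IsCylinder.measure_avoid_le (hQ : IsGenerator Q) (hX : IsMarkovChain Q X P) {A : Finset E}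
    {β : ℝ} {T : ℝ≥0} (hT : ∀ x, ∃ s : ℝ≥0, s ≤ T ∧ β ≤ ∑ y ∈ A, transProb Q s x y) (x : E)
    (n : ℕ) {τ : ℝ≥0} {y : E} {C : Set Ω} (hC : IsCylinder X τ y C) :
    P x (C ∩ {ω | ∀ u, τ ≤ u → u ≤ τ + n * T → X u ω ∉ A}) ≤
      P x C * ENNReal.ofReal (1 - β) ^ n := by
  induction n generalizing τ y C with
  | zero => simpa using measure_mono Set.inter_subset_left
  | succ n ih =>
    obtain ⟨s, hsT, hs⟩ := hT y
    set q := ENNReal.ofReal (1 - β) with hq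
    have hτT : τ + s + (T - s) = τ + T := by rw [add_assoc, add_tsub_cancel_of_le hsT]
    -- The state `z` at `τ + s` lies outside `A`, which costs the factor `1 - β`. The state `w` at
    -- `τ + T` gives the induction a cylinder ending exactly one period later, and is summed out.
    have hsub : C ∩ {ω | ∀ u, τ ≤ u → u ≤ τ + (n + 1 : ℕ) * T → X u ω ∉ A} ⊆
        ⋃ z ∈ Aᶜ, ⋃ w ∈ (Finset.univ : Finset E),
          ((C ∩ {ω | X (τ + s) ω = z}) ∩ {ω | X (τ + s + (T - s)) ω = w}) ∩
            {ω | ∀ u, τ + s + (T - s) ≤ u → u ≤ τ + s + (T - s) + n * T → X u ω ∉ A} := by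
      rintro ω ⟨hωC, hω⟩
      simp only [Set.mem_iUnion]
      have hle : T ≤ (n + 1 : ℕ) * T := by
        push_cast
        rw [add_mul, one_mul]
        exact le_add_self
      refine ⟨X (τ + s) ω, Finset.mem_compl.2 (hω _ le_self_add ?_), X (τ + s + (T - s)) ω,
        Finset.mem_univ _, ⟨⟨hωC, rfl⟩, rfl⟩, fun u hu1 hu2 => hω u ?_ ?_⟩
      · gcongr
        exact hsT.trans hle
      · rw [hτT] at hu1
        exact le_self_add.trans hu1
      · rw [hτT] at hu2
        refine hu2.trans (le_of_eq ?_)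
        push_cast
        ring
    calc _ ≤ _ := measure_mono hsub
      _ ≤ ∑ z ∈ Aᶜ, ∑ w, P x (((C ∩ {ω | X (τ + s) ω = z}) ∩
            {ω | X (τ + s + (T - s)) ω = w}) ∩
            {ω | ∀ u, τ + s + (T - s) ≤ u → u ≤ τ + s + (T - s) + n * T → X u ω ∉ A}) :=
          (measure_biUnion_finset_le _ _).trans
            (Finset.sum_le_sum fun z _ => measure_biUnion_finset_le _ _)
      _ ≤ ∑ z ∈ Aᶜ, ∑ w, P x C * ENNReal.ofReal (transProb Q s y z) *
            ENNReal.ofReal (transProb Q ((T - s : ℝ≥0) : ℝ) z w) * q ^ n := by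
          refine Finset.sum_le_sum fun z _ => Finset.sum_le_sum fun w _ => ?_
          have hz := hC.inter s z
          rw [← hC.measure_inter hQ hX x s z, ← hz.measure_inter hQ hX x (T - s) w]
          exact ih (hz.inter (T - s) w)
      _ = P x C * q ^ n * ∑ z ∈ Aᶜ, ENNReal.ofReal (transProb Q s y z) := by
          simp only [← Finset.sum_mul, ← Finset.mul_sum, sum_ofReal_transProb hQ hX, mul_one]
          ring
      _ ≤ P x C * q ^ n * q := by
          gcongr
          rw [← ENNReal.ofReal_sum_of_nonneg fun z _ => transProb_nonneg hQ hX s y z]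
          refine ENNReal.ofReal_le_ofReal ?_
          have := Finset.sum_add_sum_compl A fun z => transProb Q s y z
          rw [sum_transProb hQ] at this
          linarith
      _ = P x C * q ^ (n + 1) := by ring

lemma measure_avoid_le (hQ : IsGenerator Q) (hX : IsMarkovChain Q X P) {A : Finset E}
    {β : ℝ} {T : ℝ≥0} (hT : ∀ x, ∃ s : ℝ≥0, s ≤ T ∧ β ≤ ∑ y ∈ A, transProb Q s x y) (x : E)
    (n : ℕ) : P x {ω | ∀ u ≤ n * T, X u ω ∉ A} ≤ ENNReal.ofReal (1 - β) ^ n := by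
  have hp : ∀ y, P x {ω | X 0 ω = y} = ENNReal.ofReal (transProb Q (0 : ℝ≥0) x y) := fun y => by
    simpa using hX.finite_dim x 0 (fun _ => 0) (fun _ => y) monotone_const
  have hsub : {ω | ∀ u ≤ n * T, X u ω ∉ A} ⊆ ⋃ y ∈ (Finset.univ : Finset E),
      {ω | X 0 ω = y} ∩ {ω | ∀ u, 0 ≤ u → u ≤ 0 + n * T → X u ω ∉ A} := by
    intro ω hω
    simp only [Set.mem_iUnion]
    exact ⟨X 0 ω, Finset.mem_univ _, rfl, fun u _ hu => hω u (by simpa using hu)⟩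
  calc _ ≤ _ := measure_mono hsub
    _ ≤ ∑ y, P x {ω | X 0 ω = y} * ENNReal.ofReal (1 - β) ^ n :=
      (measure_biUnion_finset_le _ _).trans (Finset.sum_le_sum fun y _ =>
        (isCylinder_single X 0 y).measure_avoid_le hQ hX hT x n)
    _ = ENNReal.ofReal (1 - β) ^ n := by
      simp only [hp]
      rw [← Finset.sum_mul, sum_ofReal_transProb hQ hX, one_mul]

/-! ### Expected hitting times from geometric tails -/

omit [Fintype E] [DecidableEq E] [MeasurableSpace Ω] in
-- `H_A` is at most `T` times the number of `n` for which `A` is avoided up to `n T`. Supersets `D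
-- n` are allowed so that measurable hulls can replace the avoidance events.
lemma hittingTime_le_tsum (X : ℝ≥0 → Ω → E) (A : Finset E) {T : ℝ≥0} (hT : T ≠ 0) (ω : Ω)
    {D : ℕ → Set Ω} (hD : ∀ n : ℕ, {ω | ∀ u ≤ n * T, X u ω ∉ A} ⊆ D n) :
    hittingTime X A ω ≤ ∑' n, (D n).indicator (fun _ => (T : ℝ≥0∞)) ω := by
  by_cases h : ∀ n, ω ∈ D n
  · simp only [Set.indicator_of_mem (h _)]
    rw [ENNReal.tsum_const_eq_top_of_ne_zero (by simpa using hT)]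
    exact le_top
  · push Not at h
    classical
    obtain ⟨n, hn, hlt⟩ : ∃ n, ω ∉ D n ∧ ∀ m < n, ω ∈ D m :=
      ⟨Nat.find h, Nat.find_spec h, fun m hm => not_not.1 (Nat.find_min h hm)⟩
    have hn' : ω ∉ {ω | ∀ u ≤ n * T, X u ω ∉ A} := fun hω => hn (hD n hω)
    simp only [Set.mem_ofPred_eq, not_forall, not_not] at hn'
    obtain ⟨u, hu, huA⟩ := hn'
    calc hittingTime X A ω ≤ u := iInf₂_le u huA
      _ ≤ ((n * T : ℝ≥0) : ℝ≥0∞) := by exact_mod_cast hu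
      _ = ∑ m ∈ Finset.range n, (D m).indicator (fun _ => (T : ℝ≥0∞)) ω := by
        rw [Finset.sum_congr rfl fun m hm =>
          Set.indicator_of_mem (hlt m (Finset.mem_range.1 hm)) _]
        simp
      _ ≤ _ := ENNReal.sum_le_tsum _

omit [DecidableEq E] [MeasurableSpace Ω] in
lemma hittingTime_univ (X : ℝ≥0 → Ω → E) (ω : Ω) : hittingTime X Finset.univ ω = 0 := by
  unfold hittingTime
  exact le_antisymm (iInf₂_le (0 : ℝ≥0) (Finset.mem_univ (X 0 ω))) bot_le

lemma lintegral_hittingTime_le (hQ : IsGenerator Q) (hX : IsMarkovChain Q X P) {A : Finset E}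
    {β : ℝ} {T : ℝ≥0} (hβ0 : 0 < β) (hβ1 : β ≤ 1)
    (hT : ∀ x, ∃ s : ℝ≥0, s ≤ T ∧ β ≤ ∑ y ∈ A, transProb Q s x y) (x : E) :
    ∫⁻ ω, hittingTime X A ω ∂(P x) ≤ T * ENNReal.ofReal β⁻¹ := by
  rcases eq_or_ne T 0 with rfl | hT0
  -- For `T = 0` the series bound is unavailable; but `p_0` is the identity, so `A` contains every
  -- state.
  · have hA : A = Finset.univ := by
      refine Finset.eq_univ_iff_forall.2 fun y => ?_
      obtain ⟨s, hs, hle⟩ := hT y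
      rw [nonpos_iff_eq_zero.1 hs, NNReal.coe_zero, transProb_zero] at hle
      by_contra hy
      rw [Finset.sum_eq_zero fun z hz =>
        Matrix.one_apply_ne (ne_of_mem_of_not_mem hz hy).symm] at hle
      linarith
    simp [hA, hittingTime_univ]
  · set D : ℕ → Set Ω := fun n => toMeasurable (P x) {ω | ∀ u ≤ n * T, X u ω ∉ A} with hD
    have hDm : ∀ n, MeasurableSet (D n) := fun n => measurableSet_toMeasurable _ _
    calc ∫⁻ ω, hittingTime X A ω ∂(P x)
        ≤ ∫⁻ ω, ∑' n, (D n).indicator (fun _ => (T : ℝ≥0∞)) ω ∂(P x) :=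
          lintegral_mono fun ω => hittingTime_le_tsum X A hT0 ω fun n => subset_toMeasurable _ _
      _ = ∑' n, T * P x (D n) := by
          rw [lintegral_tsum fun n => (measurable_const.indicator (hDm n)).aemeasurable]
          simp only [lintegral_indicator_const (hDm _)]
      _ ≤ ∑' n, T * ENNReal.ofReal (1 - β) ^ n := by
          refine ENNReal.tsum_le_tsum fun n => ?_
          gcongr
          rw [hD, measure_toMeasurable]
          exact measure_avoid_le hQ hX hT x n
      _ = T * ENNReal.ofReal β⁻¹ := by
          rw [ENNReal.tsum_mul_left, ENNReal.tsum_geometric, ENNReal.ofReal_inv_of_pos hβ0,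
            ← ENNReal.ofReal_one, ← ENNReal.ofReal_sub _ (by linarith), sub_sub_cancel]

end Chain

end FiniteChain
end

theorem mainTheorem4 (α : ℝ) (hα0 : 0 < α) (hα1 : α < 1) :
    ∃ c : ℝ≥0, 0 < c ∧
      ∀ (E : Type*) [Fintype E] [DecidableEq E] (Q : Matrix E E ℝ) (π : E → ℝ)
        (Ω : Type*) [MeasurableSpace Ω] (X : ℝ≥0 → Ω → E) (P : E → Measure Ω),
        FiniteChain.IsGenerator Q → FiniteChain.IsIrreducible Q →
        FiniteChain.IsStationary Q π → FiniteChain.IsMarkovChain Q X P →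
        FiniteChain.Thit X P π α ≤ (c : ℝ≥0∞) * FiniteChain.Trmix Q π (1 / 4) := by
  obtain ⟨k, hk⟩ := exists_pow_lt_of_lt_one (half_pos hα0) (show (1 / 2 : ℝ) < 1 by norm_num)
  -- Needed for `c > 0`.
  have hk0 : k ≠ 0 := by
    rintro rfl
    rw [pow_zero] at hk
    linarith
  have hc : 0 < (k : ℝ≥0) * (α / 2)⁻¹.toNNReal := by positivity
  refine ⟨k * (α / 2)⁻¹.toNNReal, hc, fun E _ _ Q π Ω _ X P hQ _ hπ hX => ?_⟩
  have hcE : (((k : ℝ≥0) * (α / 2)⁻¹.toNNReal : ℝ≥0) : ℝ≥0∞) ≠ 0 := by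
    exact_mod_cast hc.ne'
  unfold FiniteChain.Trmix
  -- A finite nonzero constant passes under both infima, so it suffices to bound `Thit` by `c * t`
  -- for each admissible `t`.
  rw [ENNReal.mul_iInf_of_ne hcE ENNReal.coe_ne_top]
  refine le_iInf fun t => ?_
  rw [ENNReal.mul_iInf_of_ne hcE ENNReal.coe_ne_top]
  refine le_iInf fun ⟨μ, hμp, hμ, hd⟩ => ?_
  refine iSup_le fun x => iSup_le fun A => iSup_le fun _ => iSup_le fun hA => ?_
  refine (FiniteChain.lintegral_hittingTime_le hQ hX (half_pos hα0) (by linarith)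
    (FiniteChain.exists_transProb_ge hQ hπ hμ hd hk.le hA) x).trans (le_of_eq ?_)
  rw [ENNReal.ofReal]
  push_cast
  ring
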